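/- Let $f:\mathbb{R}^n\to\mathbb{R}$ be convex and bounded below (for instance $f(x)=\frac12\|Ax-y\|^2$), let $\lambda>0$, and write $\operatorname{prox}_{\varphi}(u)=\operatorname{argmin}_z\,\varphi(z)+\frac12\|z-u\|^2$. Let $C\subset\mathbb{R}^n$ be a nonempty closed set, with distance function $d_C(x)=\inf_{u\in C}\|x-u\|$, such that $d_C^2$ is differentiable on $\mathbb{R}^n$. Let $R:\mathbb{R}^m\to\mathbb{R}^n$ be a restoration model and let $(H_k)_{k\ge 0}$, $(w_k)_{k\ge0}$ be random (linear or nonlinear) degradation operators $\mathbb{R}^n\to\mathbb{R}^m$ and random noise vectors in $\mathbb{R}^m$ on a probability space with a filtration $(\mathcal{F}_k)_{k\ge 0}$. Consider the stochastic proximal gradient iteration $$g_k=x_k-R(H_kx_k+w_k),\qquad x_{k+1}=\operatorname{prox}_{\gamma_k\lambda f}(x_k-\gamma_k g_k),\qquad k\ge 0,$$ with step sizes $\gamma_k>0$, where $(x_k)$ is adapted to $(\mathcal{F}_k)$, $x_0$ is square-integrable (for instance deterministic) and every $g_k$ has a finite second moment. Assume that for all $k$, almost surely, $$\mathbb{E}[g_k\mid\mathcal{F}_k]=\tfrac12\nabla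 d_C^2(x_k),\qquad \mathbb{E}\big[\|g_k-\tfrac12\nabla d_C^2(x_k)\|^2\,\big|\,\mathcal{F}_k\big]\le A\,d_C^2(x_k)+B$$ for some constants $A,B\ge0$, and that $\sum_k\gamma_k=\infty$ and $\sum_k\gamma_k^2<\infty$. Let $$F(x)=x-\operatorname{prox}_{\lambda f}\big(x-\tfrac12\nabla d_C^2(x)\big).$$ Then every $F(x_k)$ is integrable, $\mathbb{E}[F(x_k)]\to0$ as $k\to\infty$, and moreover $\mathbb{E}[\|F(x_k)\|]\to0$. -/

import Mathlib

open MeasureTheory Filter Topology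

noncomputable section

namespace FiRe

/-- `p` is a minimizer of `z ↦ φ z + ½ ‖z - u‖²`. -/
def IsProx {n : ℕ} (φ : EuclideanSpace ℝ (Fin n) → ℝ) (u p : EuclideanSpace ℝ (Fin n)) : Prop :=
  ∀ z : EuclideanSpace ℝ (Fin n), φ p + 1 / 2 * ‖p - u‖ ^ 2 ≤ φ z + 1 / 2 * ‖z - u‖ ^ 2

/-- The proximity operator `prox_φ(u) = argmin_z φ z + ½ ‖z - u‖²`. For a convex `φ`, the only case
in which it is used, the minimizer exists and is unique. -/
def prox {n : ℕ} (φ : EuclideanSpace ℝ (Fin n) → ℝ) (u : EuclideanSpace ℝ (Fin n)) :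
    EuclideanSpace ℝ (Fin n) :=
  Classical.epsilon (IsProx φ u)

/-- The squared distance function `d_C²`. -/
def sqDist {n : ℕ} (C : Set (EuclideanSpace ℝ (Fin n))) (x : EuclideanSpace ℝ (Fin n)) : ℝ :=
  Metric.infDist x C ^ 2

/-- The vector `½ ∇ d_C² (x)`. -/
def halfGradSqDist {n : ℕ} (C : Set (EuclideanSpace ℝ (Fin n))) (x : EuclideanSpace ℝ (Fin n)) :
    EuclideanSpace ℝ (Fin n) :=
  (1 / 2 : ℝ) • gradient (sqDist C) x

/-- The residual `F(x) = x - prox_{λ f}(x - ½ ∇ d_C² (x))`, with `lam` for `λ`. -/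
def residual {n : ℕ} (lam : ℝ) (f : EuclideanSpace ℝ (Fin n) → ℝ)
    (C : Set (EuclideanSpace ℝ (Fin n))) (x : EuclideanSpace ℝ (Fin n)) :
    EuclideanSpace ℝ (Fin n) :=
  x - prox (fun z => lam * f z) (x - halfGradSqDist C x)

/-- The stochastic estimate `x - R (H x + w)` built from a restoration model `R`, one realisation
`H` of the (linear or nonlinear) degradation operator and one realisation `w` of the noise. -/
def estimate {n m : ℕ} (R : EuclideanSpace ℝ (Fin m) → EuclideanSpace ℝ (Fin n))
    (H : EuclideanSpace ℝ (Fin n) → EuclideanSpace ℝ (Fin m)) (w : EuclideanSpace ℝ (Fin m))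
    (x : EuclideanSpace ℝ (Fin n)) : EuclideanSpace ℝ (Fin n) :=
  x - R (H x + w)

end FiRe

end

/-!
Write `φ = λ f`, `h = ½ d_C²` and `Ψ = φ + h`. The function `Ψ` is convex and bounded below, but it
need not have a minimizer, so the distance to a solution is not available as a Lyapunov function.
Its Moreau envelope `M x = min_z Ψ z + ½ ‖z - x‖²`, attained at `T x = prox_Ψ x`, is used instead.

*The set `C`.* Differentiability of `d_C²` gives `½ ∇ d_C² x = x - p` for any nearest point `p` of
`x`. Maximizing `d_C` over the ball about `x` of radius `d_C x` shows that `p` stays nearest to the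
points `p + 2 ^ k • (x - p)`, hence `⟪x - p, c - p⟫ ≤ 0` on `C` (`IsNearest.inner_nonpos`). So `h`
is convex with a `1`-Lipschitz gradient (`isSmoothConvex_sqDist`).

*One step.* For every `z` known at time `k`, including random ones, and `γ k ≤ 1`,
`E ‖x_{k+1} - z‖² ≤ E ‖x_k - z‖² - 2 γ_k (E Ψ x_{k+1} - E Ψ z) + 2 γ_k² σ_k`, where `σ_k` is the
expected squared error of `g_k` (`integral_norm_sub_sq_le`). Measuring the error against the exact
step, which is known at time `k`, makes its first-order contribution vanish.

*Conclusion.* With `z = T x_k` the inequality yields `E M x_{k+1} ≤ E M x_k + γ_k² σ_k`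
(`integral_moreau_le`). Since `σ_k` is bounded by an affine function of `E M x_k`, the sequence
`E M x_k` converges to some `L`. With a constant `z` and the divergence of `∑ γ_k` it yields
`L ≤ Ψ z`, so `L = inf Ψ`. As `½ ‖x - T x‖² ≤ M x - inf Ψ`, the points `x_k` and `T x_k` become close
in mean square (`tendsto_integral_norm_sub_prox_sq`). Finally `T x = prox_φ (x - ∇ h (T x))` gives
`‖F x‖ ≤ 2 ‖x - T x‖` (`IsProx.norm_sub_prox_le`).
-/

open scoped RealInnerProductSpace

namespace FiRe

/-! ### Nearest points of a set whose squared distance is differentiable -/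

section Nearest

variable {n : ℕ} {C : Set (EuclideanSpace ℝ (Fin n))}

/-- `p` is a point of `C` nearest to `x`. -/
def IsNearest (C : Set (EuclideanSpace ℝ (Fin n))) (x p : EuclideanSpace ℝ (Fin n)) : Prop :=
  p ∈ C ∧ ∀ c ∈ C, ‖x - p‖ ≤ ‖x - c‖

lemma exists_isNearest (hC : IsClosed C) (hne : C.Nonempty) (x : EuclideanSpace ℝ (Fin n)) :
    ∃ p, IsNearest C x p := by
  obtain ⟨p, hp, h⟩ := hC.exists_infDist_eq_dist hne x
  refine ⟨p, hp, fun c hc => ?_⟩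
  rw [← dist_eq_norm, ← dist_eq_norm, ← h]
  exact Metric.infDist_le_dist_of_mem hc

lemma sqDist_le {c : EuclideanSpace ℝ (Fin n)} (hc : c ∈ C) (x : EuclideanSpace ℝ (Fin n)) :
    sqDist C x ≤ ‖x - c‖ ^ 2 := by
  rw [← dist_eq_norm]
  exact pow_le_pow_left₀ Metric.infDist_nonneg (Metric.infDist_le_dist_of_mem hc) 2

lemma sqDist_nonneg (x : EuclideanSpace ℝ (Fin n)) : 0 ≤ sqDist C x := sq_nonneg _

lemma IsNearest.sqDist_eq {x p : EuclideanSpace ℝ (Fin n)} (h : IsNearest C x p) :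
    sqDist C x = ‖x - p‖ ^ 2 := by
  refine le_antisymm (sqDist_le h.1 x) (pow_le_pow_left₀ (norm_nonneg _) ?_ 2)
  refine (Metric.le_infDist ⟨p, h.1⟩).2 fun c hc => ?_
  rw [dist_eq_norm]
  exact h.2 c hc

/-- The function `y ↦ d_C² y - ‖y - p‖²` is maximal at `x`, so its gradient vanishes there. In
particular the nearest point is unique. -/
lemma IsNearest.halfGrad_eq (hd : Differentiable ℝ (sqDist C)) {x p : EuclideanSpace ℝ (Fin n)}
    (h : IsNearest C x p) : halfGradSqDist C x = x - p := by
  have h1 := (hd x).hasGradientAt.hasFDerivAt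
  have h2 : HasFDerivAt (fun y => ‖y - p‖ ^ 2) (2 • innerSL ℝ (x - p)) x := by
    simpa using ((hasFDerivAt_id x).sub_const p).norm_sq
  have hmax : IsLocalMax (fun y => sqDist C y - ‖y - p‖ ^ 2) x := by
    refine Eventually.of_forall fun y => ?_
    have := sqDist_le h.1 y
    simp only [h.sqDist_eq]
    linarith
  have h0 := hmax.hasFDerivAt_eq_zero (h1.sub h2)
  unfold halfGradSqDist
  refine ext_inner_right ℝ fun v => ?_
  have : ⟪gradient (sqDist C) x, v⟫ - (2 : ℕ) • ⟪x - p, v⟫ = 0 := DFunLike.congr_fun h0 v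
  rw [nsmul_eq_mul, Nat.cast_ofNat] at this
  rw [real_inner_smul_left]
  linarith

/-- The nearest point of `x` remains nearest when the distance from it is doubled along the ray
through `x`: this is seen at a point that maximizes the distance over the ball about `x` of radius
`d_C x`. -/
lemma IsNearest.double (hC : IsClosed C) (hd : Differentiable ℝ (sqDist C))
    {x p : EuclideanSpace ℝ (Fin n)} (h : IsNearest C x p) :
    IsNearest C (p + (2 : ℝ) • (x - p)) p := by
  rcases eq_or_ne x p with rfl | hxp
  · simpa using h
  set r := ‖x - p‖ with hr
  have hr0 : 0 < r := norm_pos_iff.2 (sub_ne_zero.2 hxp)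
  obtain ⟨y, hy, hmax⟩ := (isCompact_closedBall x r).exists_isMaxOn
    ⟨x, Metric.mem_closedBall_self hr0.le⟩ hd.continuous.continuousOn
  obtain ⟨q, hq⟩ := exists_isNearest hC ⟨p, h.1⟩ y
  have hyx : ‖y - x‖ ≤ r := by simpa [dist_eq_norm] using hy
  have hv : r ≤ ‖y - q‖ := by
    have : sqDist C x ≤ sqDist C y := hmax (Metric.mem_closedBall_self hr0.le)
    rw [h.sqDist_eq, hq.sqDist_eq] at this
    exact le_of_sq_le_sq this (norm_nonneg _)
  set v := y - q with hvdef
  have hv0 : 0 < ‖v‖ := hr0.trans_le hv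
  -- the first-order condition at the maximizer
  have hfo : ∀ z ∈ Metric.closedBall x r, ⟪v, z - y⟫ ≤ 0 := by
    intro z hz
    have h1 := (hd y).hasGradientAt.hasFDerivAt
    have h2 : ⟪gradient (sqDist C) y, z - y⟫ ≤ 0 :=
      hmax.localize.hasFDerivWithinAt_nonpos h1.hasFDerivWithinAt
      (sub_mem_posTangentConeAt_of_segment_subset
        ((convex_closedBall x r).segment_subset hy hz))
    have h3 := hq.halfGrad_eq hd
    rw [← hvdef] at h3
    rw [← h3, halfGradSqDist, real_inner_smul_left]
    linarith
  have hyeq : y - x = (r / ‖v‖) • v := by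
    have h1 := hfo (x + (r / ‖v‖) • v) (by
      simp [norm_smul, abs_of_pos hr0, hv0.ne'])
    have h2 : r * ‖v‖ ≤ ⟪v, y - x⟫ := by
      have : x + (r / ‖v‖) • v - y = (r / ‖v‖) • v - (y - x) := by abel
      rw [this, inner_sub_right, real_inner_smul_right, real_inner_self_eq_norm_sq] at h1
      have : r / ‖v‖ * ‖v‖ ^ 2 = r * ‖v‖ := by field_simp
      linarith
    have h3 : ‖(y - x) - (r / ‖v‖) • v‖ ^ 2 ≤ 0 := by
      rw [norm_sub_sq_real, real_inner_smul_right, real_inner_comm, norm_smul, Real.norm_eq_abs,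
        abs_of_pos (div_pos hr0 hv0), div_mul_cancel₀ _ hv0.ne']
      have h4 : r ^ 2 ≤ r / ‖v‖ * ⟪v, y - x⟫ := by
        calc r ^ 2 = r / ‖v‖ * (r * ‖v‖) := by field_simp
          _ ≤ _ := mul_le_mul_of_nonneg_left h2 (div_pos hr0 hv0).le
      have h5 : ‖y - x‖ ^ 2 ≤ r ^ 2 := pow_le_pow_left₀ (norm_nonneg _) hyx 2
      linarith
    have h4 : ‖(y - x) - (r / ‖v‖) • v‖ = 0 := by
      have := sq_nonneg ‖(y - x) - (r / ‖v‖) • v‖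
      exact pow_eq_zero_iff (two_ne_zero) |>.1 (le_antisymm h3 this)
    exact sub_eq_zero.1 (norm_eq_zero.1 h4)
  have hxq : x - q = (1 - r / ‖v‖) • v := by
    rw [sub_smul, one_smul, ← hyeq, hvdef]; abel
  have hnxq : ‖x - q‖ = ‖v‖ - r := by
    rw [hxq, norm_smul, Real.norm_eq_abs, abs_of_nonneg (sub_nonneg.2 ((div_le_one hv0).2 hv))]
    field_simp
  have hqx : IsNearest C x q := by
    refine ⟨hq.1, fun c hc => ?_⟩
    have h1 := hq.2 c hc
    have h2 := norm_add_le (y - x) (x - c)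
    rw [sub_add_sub_cancel] at h2
    linarith
  have hpq : q = p := by
    have := (hqx.halfGrad_eq hd).symm.trans (h.halfGrad_eq hd)
    exact sub_right_injective this
  rw [hpq] at hnxq hxq hq
  have hvr : ‖v‖ = 2 * r := by linarith
  have : p + (2 : ℝ) • (x - p) = y := by
    rw [hxq, hvr, smul_smul]
    have : (2 : ℝ) * (1 - r / (2 * r)) = 1 := by field_simp; norm_num
    rw [this, one_smul, hvdef, hpq]; abel
  rw [this]
  exact hq

/-- The obtuse-angle property of the projection. The nearest point `p` of `x` is nearest to
`p + 2 ^ k • (x - p)` for every `k`, so `C` misses the open balls about these points with `p` on the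
boundary, and these exhaust the open half-space `⟪x - p, · - p⟫ > 0`. -/
lemma IsNearest.inner_nonpos (hC : IsClosed C) (hd : Differentiable ℝ (sqDist C))
    {x p c : EuclideanSpace ℝ (Fin n)} (h : IsNearest C x p) (hc : c ∈ C) :
    ⟪x - p, c - p⟫ ≤ 0 := by
  have key : ∀ k : ℕ, IsNearest C (p + (2 ^ k : ℝ) • (x - p)) p := by
    intro k
    induction k with
    | zero => simpa using h
    | succ k ih =>
      have := ih.double hC hd
      rwa [add_sub_cancel_left, smul_smul, ← pow_succ'] at this
  by_contra! hpos
  obtain ⟨k, hk⟩ := pow_unbounded_of_one_lt (‖c - p‖ ^ 2 / ⟪x - p, c - p⟫)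
    (one_lt_two : (1 : ℝ) < 2)
  rw [div_lt_iff₀ hpos] at hk
  have h1 := pow_le_pow_left₀ (norm_nonneg _) ((key k).2 c hc) 2
  have h2 : p + (2 ^ k : ℝ) • (x - p) - c = (2 ^ k : ℝ) • (x - p) - (c - p) := by abel
  rw [h2, add_sub_cancel_left, norm_sub_sq_real, real_inner_smul_left] at h1
  have : 0 < (2 : ℝ) ^ k * ⟪x - p, c - p⟫ := by positivity
  linarith

end Nearest

/-! ### Convex functions with a nonexpansive gradient -/

section Smooth

variable {n : ℕ}

/-- `G` is a gradient of the convex function `h` and is `1`-Lipschitz, expressed by the two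
inequalities between `h` and its linearizations. -/
structure IsSmoothConvex (h : EuclideanSpace ℝ (Fin n) → ℝ)
    (G : EuclideanSpace ℝ (Fin n) → EuclideanSpace ℝ (Fin n)) : Prop where
  le_apply : ∀ x z, h x + ⟪G x, z - x⟫ ≤ h z
  apply_le : ∀ x z, h z ≤ h x + ⟪G x, z - x⟫ + 1 / 2 * ‖z - x‖ ^ 2

/-- A set with differentiable squared distance behaves like a convex set (it is one). -/
lemma isSmoothConvex_sqDist {C : Set (EuclideanSpace ℝ (Fin n))} (hC : IsClosed C)
    (hne : C.Nonempty) (hd : Differentiable ℝ (sqDist C)) :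
    IsSmoothConvex (fun x => 1 / 2 * sqDist C x) (halfGradSqDist C) where
  le_apply x z := by
    obtain ⟨p, hp⟩ := exists_isNearest hC hne x
    obtain ⟨c, hc⟩ := exists_isNearest hC hne z
    simp only [hp.sqDist_eq, hc.sqDist_eq, hp.halfGrad_eq hd]
    have h1 := hp.inner_nonpos hC hd hc.1
    have h2 : z - x = (z - c) - (x - p) + (c - p) := by abel
    rw [h2, inner_add_right, inner_sub_right, real_inner_self_eq_norm_sq]
    have h3 := sq_nonneg ‖(x - p) - (z - c)‖
    rw [norm_sub_sq_real] at h3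
    linarith
  apply_le x z := by
    obtain ⟨p, hp⟩ := exists_isNearest hC hne x
    simp only [hp.sqDist_eq, hp.halfGrad_eq hd]
    have h1 := sqDist_le hp.1 z
    have h2 : z - p = (x - p) + (z - x) := by abel
    rw [h2, norm_add_sq_real] at h1
    linarith

variable {h : EuclideanSpace ℝ (Fin n) → ℝ}
    {G : EuclideanSpace ℝ (Fin n) → EuclideanSpace ℝ (Fin n)}

/-- The linearization at `x` is exceeded by a multiple of the squared increment of the gradient:
compare the two linear bounds at the point `z - (G z - G x)`. -/
lemma IsSmoothConvex.add_norm_sq_le (hG : IsSmoothConvex h G) (x z : EuclideanSpace ℝ (Fin n)) :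
    h x + ⟪G x, z - x⟫ + 1 / 2 * ‖G z - G x‖ ^ 2 ≤ h z := by
  have h1 := hG.apply_le z (z - (G z - G x))
  have h2 := hG.le_apply x (z - (G z - G x))
  have e1 : z - (G z - G x) - z = -(G z - G x) := by abel
  have e2 : z - (G z - G x) - x = (z - x) - (G z - G x) := by abel
  rw [e1, norm_neg, inner_neg_right] at h1
  rw [e2, inner_sub_right] at h2
  have h3 := real_inner_self_eq_norm_sq (G z - G x)
  rw [inner_sub_left] at h3
  linarith

lemma IsSmoothConvex.norm_sub_le (hG : IsSmoothConvex h G) (x z : EuclideanSpace ℝ (Fin n)) :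
    ‖G z - G x‖ ≤ ‖z - x‖ := by
  have h1 := hG.add_norm_sq_le x z
  have h2 := hG.add_norm_sq_le z x
  have e1 : ‖G x - G z‖ = ‖G z - G x‖ := norm_sub_rev _ _
  have e2 : x - z = -(z - x) := by abel
  rw [e1, e2, inner_neg_right] at h2
  have h3 := real_inner_le_norm (G z - G x) (z - x)
  rw [inner_sub_left] at h3
  have h4 : ‖G z - G x‖ * ‖G z - G x‖ ≤ ‖G z - G x‖ * ‖z - x‖ := by nlinarith
  rcases (norm_nonneg (G z - G x)).eq_or_lt with h0 | h0
  · rw [← h0]; exact norm_nonneg _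
  · exact le_of_mul_le_mul_left h4 h0

lemma IsSmoothConvex.lipschitzWith (hG : IsSmoothConvex h G) : LipschitzWith 1 G :=
  LipschitzWith.of_dist_le_mul fun x z => by
    simpa [dist_eq_norm] using hG.norm_sub_le z x

lemma IsSmoothConvex.convexOn (hG : IsSmoothConvex h G) : ConvexOn ℝ Set.univ h := by
  refine ⟨convex_univ, fun x _ y _ a b ha hb hab => ?_⟩
  have h1 := mul_le_mul_of_nonneg_left (hG.le_apply (a • x + b • y) x) ha
  have h2 := mul_le_mul_of_nonneg_left (hG.le_apply (a • x + b • y) y) hb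
  have e : a * ⟪G (a • x + b • y), x - (a • x + b • y)⟫ +
      b * ⟪G (a • x + b • y), y - (a • x + b • y)⟫ = 0 := by
    rw [← real_inner_smul_right, ← real_inner_smul_right, ← inner_add_right]
    have : a • (x - (a • x + b • y)) + b • (y - (a • x + b • y)) = 0 := by
      obtain rfl : b = 1 - a := by linarith
      module
    rw [this, inner_zero_right]
  have e2 : a * h (a • x + b • y) + b * h (a • x + b • y) = h (a • x + b • y) := by
    rw [← add_mul, hab, one_mul]
  simp only [smul_eq_mul]
  linarith

end Smooth

/-! ### Proximity operators -/

section Prox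

variable {n : ℕ} {φ : EuclideanSpace ℝ (Fin n) → ℝ}

/-- A quadratic vanishing at `0` and nonnegative to the right of it has nonnegative slope there. -/
lemma nonneg_of_forall_mul_add_sq {a b : ℝ} (h : ∀ t : ℝ, 0 < t → t ≤ 1 → 0 ≤ t * a + t ^ 2 * b) :
    0 ≤ a := by
  have h1 : Tendsto (fun t : ℝ => a + t * b) (𝓝[>] 0) (𝓝 (a + 0 * b)) :=
    (Continuous.tendsto (by fun_prop) 0).mono_left nhdsWithin_le_nhds
  rw [zero_mul, add_zero] at h1
  refine ge_of_tendsto h1 ?_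
  filter_upwards [Ioc_mem_nhdsGT (zero_lt_one (α := ℝ))] with t ht
  have := h t ht.1 ht.2
  have e : t * a + t ^ 2 * b = t * (a + t * b) := by ring
  rw [e] at this
  exact nonneg_of_mul_nonneg_right this ht.1

lemma exists_isProx (hc : Continuous φ) (hb : BddBelow (Set.range φ))
    (u : EuclideanSpace ℝ (Fin n)) : ∃ p, IsProx φ u p := by
  obtain ⟨m, hm⟩ := hb
  have hlim : Tendsto (fun z : EuclideanSpace ℝ (Fin n) => φ z + 1 / 2 * ‖z - u‖ ^ 2)
      (cocompact _) atTop := by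
    refine tendsto_atTop_add_left_of_le _ m (fun z => hm ⟨z, rfl⟩) ?_
    refine Tendsto.const_mul_atTop (by norm_num) ?_
    refine (tendsto_pow_atTop two_ne_zero).comp ?_
    have := (tendsto_norm_cocompact_atTop (E := EuclideanSpace ℝ (Fin n))).comp
      (Homeomorph.subRight u).isClosedEmbedding.tendsto_cocompact
    exact this
  exact Continuous.exists_forall_le (by fun_prop) hlim

lemma isProx_prox (hφ : ConvexOn ℝ Set.univ φ) (hb : BddBelow (Set.range φ))
    (u : EuclideanSpace ℝ (Fin n)) : IsProx φ u (prox φ u) :=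
  Classical.epsilon_spec (exists_isProx hφ.locallyLipschitz.continuous hb u)

/-- The optimality condition for a proximal point `p` of `φ + h`: the vector `u - G p - p` is a
subgradient of `φ` at `p`. -/
lemma IsProx.le_of_add_smooth {h : EuclideanSpace ℝ (Fin n) → ℝ}
    {G : EuclideanSpace ℝ (Fin n) → EuclideanSpace ℝ (Fin n)} (hφ : ConvexOn ℝ Set.univ φ)
    (hG : IsSmoothConvex h G) {u p : EuclideanSpace ℝ (Fin n)}
    (hp : IsProx (fun z => φ z + h z) u p) (z : EuclideanSpace ℝ (Fin n)) :
    φ p + ⟪u - G p - p, z - p⟫ ≤ φ z := by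
  have key : 0 ≤ φ z - φ p - ⟪u - G p - p, z - p⟫ := by
    refine nonneg_of_forall_mul_add_sq (b := ‖z - p‖ ^ 2) fun t ht ht1 => ?_
    have h1 := hp (p + t • (z - p))
    have h2 := hφ.2 (Set.mem_univ p) (Set.mem_univ z) (sub_nonneg.2 ht1) ht.le (by ring)
    have e : (1 - t) • p + t • z = p + t • (z - p) := by module
    rw [e, smul_eq_mul, smul_eq_mul] at h2
    have h3 := hG.apply_le p (p + t • (z - p))
    have e2 : p + t • (z - p) - u = (p - u) + t • (z - p) := by abel
    rw [e2, norm_add_sq_real] at h1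
    simp only [add_sub_cancel_left, real_inner_smul_right, norm_smul, Real.norm_eq_abs,
      mul_pow, sq_abs] at h1 h3
    have e3 : u - G p - p = -(p - u) - G p := by abel
    rw [e3, inner_sub_left, inner_neg_left]
    linarith
  linarith

lemma isSmoothConvex_zero :
    IsSmoothConvex (fun _ : EuclideanSpace ℝ (Fin n) => (0 : ℝ)) fun _ => 0 where
  le_apply x z := by simp
  apply_le x z := by simp

lemma IsProx.le_of_convexOn (hφ : ConvexOn ℝ Set.univ φ) {u p : EuclideanSpace ℝ (Fin n)}
    (hp : IsProx φ u p) (z : EuclideanSpace ℝ (Fin n)) : φ p + ⟪u - p, z - p⟫ ≤ φ z := by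
  have := IsProx.le_of_add_smooth (u := u) (p := p) hφ isSmoothConvex_zero
    (by simpa [IsProx] using hp) z
  simpa using this

lemma isProx_of_forall_le {u p : EuclideanSpace ℝ (Fin n)}
    (hp : ∀ z, φ p + ⟪u - p, z - p⟫ ≤ φ z) : IsProx φ u p := by
  intro z
  have e : z - u = (z - p) - (u - p) := by abel
  rw [norm_sub_rev p u, e, norm_sub_sq_real (z - p), real_inner_comm]
  have := hp z
  have := sq_nonneg ‖z - p‖
  linarith

lemma IsProx.norm_sub_le (hφ : ConvexOn ℝ Set.univ φ) {u v p q : EuclideanSpace ℝ (Fin n)}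
    (hp : IsProx φ u p) (hq : IsProx φ v q) : ‖p - q‖ ≤ ‖u - v‖ := by
  have h1 := hp.le_of_convexOn hφ q
  have h2 := hq.le_of_convexOn hφ p
  have h3 : ⟪p - q, p - q⟫ ≤ ⟪u - v, p - q⟫ := by
    have e1 : q - p = -(p - q) := by abel
    have e2 : u - v = (u - p) - (v - q) + (p - q) := by abel
    rw [e1, inner_neg_right] at h1
    rw [e2, inner_add_left, inner_sub_left (u - p)]
    linarith
  have h4 := h3.trans (real_inner_le_norm _ _)
  rw [real_inner_self_eq_norm_mul_norm] at h4
  rcases (norm_nonneg (p - q)).eq_or_lt with h0 | h0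
  · rw [← h0]; exact norm_nonneg _
  · exact le_of_mul_le_mul_right h4 h0

lemma lipschitzWith_prox (hφ : ConvexOn ℝ Set.univ φ) (hb : BddBelow (Set.range φ)) :
    LipschitzWith 1 (prox φ) :=
  LipschitzWith.of_dist_le_mul fun u v => by
    simpa [dist_eq_norm] using (isProx_prox hφ hb u).norm_sub_le hφ (isProx_prox hφ hb v)

/-- The residual at `x` is controlled by the displacement to the proximal point `p` of `φ + h`: the
optimality condition says `p = prox φ (x - G p)`, and replacing `G p` by `G x` costs at most
`‖x - p‖`. -/
lemma IsProx.norm_sub_prox_le {h : EuclideanSpace ℝ (Fin n) → ℝ}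
    {G : EuclideanSpace ℝ (Fin n) → EuclideanSpace ℝ (Fin n)} (hφ : ConvexOn ℝ Set.univ φ)
    (hb : BddBelow (Set.range φ)) (hG : IsSmoothConvex h G) {x p : EuclideanSpace ℝ (Fin n)}
    (hp : IsProx (fun z => φ z + h z) x p) : ‖x - prox φ (x - G x)‖ ≤ 2 * ‖x - p‖ := by
  have h1 : IsProx φ (x - G p) p := isProx_of_forall_le (hp.le_of_add_smooth hφ hG)
  have h2 := h1.norm_sub_le hφ (isProx_prox hφ hb (x - G x))
  have h3 : ‖x - G p - (x - G x)‖ ≤ ‖x - p‖ := by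
    rw [sub_sub_sub_cancel_left]; exact hG.norm_sub_le p x
  have h4 := norm_add_le (x - p) (p - prox φ (x - G x))
  rw [sub_add_sub_cancel] at h4
  linarith

/-- One step of the proximal gradient method with a perturbed gradient `g`, against an arbitrary
point `z`. The error term is linear in the error `g - G x` and multiplies the distance from `z`
to the exact step `y`, up to a quadratic remainder. -/
lemma IsProx.norm_sub_sq_le {h : EuclideanSpace ℝ (Fin n) → ℝ}
    {G : EuclideanSpace ℝ (Fin n) → EuclideanSpace ℝ (Fin n)} (hφ : ConvexOn ℝ Set.univ φ)
    (hG : IsSmoothConvex h G) {γ : ℝ} (hγ : 0 < γ) (hγ1 : γ ≤ 1)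
    {x g p y : EuclideanSpace ℝ (Fin n)} (hp : IsProx (fun z => γ * φ z) (x - γ • g) p)
    (hy : IsProx (fun z => γ * φ z) (x - γ • G x) y) (z : EuclideanSpace ℝ (Fin n)) :
    ‖p - z‖ ^ 2 ≤ ‖x - z‖ ^ 2 - 2 * γ * ((φ p + h p) - (φ z + h z))
      + 2 * γ ^ 2 * ‖g - G x‖ ^ 2 - 2 * γ * ⟪g - G x, y - z⟫ := by
  have hγφ : ConvexOn ℝ Set.univ fun z => γ * φ z := hφ.smul hγ.le
  have h1 := hp.le_of_convexOn hγφ z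
  have h2 := mul_le_mul_of_nonneg_left (hG.apply_le x p) hγ.le
  have h3 := mul_le_mul_of_nonneg_left (hG.le_apply x z) hγ.le
  have h4 : ‖y - p‖ ≤ γ * ‖g - G x‖ := by
    have := hy.norm_sub_le hγφ hp
    have e : x - γ • G x - (x - γ • g) = γ • (g - G x) := by module
    rwa [e, norm_smul, Real.norm_eq_abs, abs_of_pos hγ] at this
  have h5 : γ * ⟪g - G x, y - p⟫ ≤ γ ^ 2 * ‖g - G x‖ ^ 2 := by
    calc γ * ⟪g - G x, y - p⟫ ≤ γ * (‖g - G x‖ * (γ * ‖g - G x‖)) :=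
          mul_le_mul_of_nonneg_left ((real_inner_le_norm _ _).trans
            (mul_le_mul_of_nonneg_left h4 (norm_nonneg _))) hγ.le
      _ = _ := by ring
  have e1 : x - γ • g - p = -(p - x) - γ • (g - G x) - γ • G x := by module
  have e2 : y - p = (y - z) - (p - x) + (z - x) := by abel
  have e3 : p - z = (p - x) - (z - x) := by abel
  have e4 : z - p = (z - x) - (p - x) := by abel
  rw [e2, inner_add_right, inner_sub_right] at h5
  rw [norm_sub_rev x z, e3, norm_sub_sq_real]
  rw [e1, e4] at h1
  simp only [inner_sub_left (E := EuclideanSpace ℝ (Fin n)) _ (γ • G x),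
    inner_sub_left (E := EuclideanSpace ℝ (Fin n)) (-(p - x)) (γ • (g - G x)),
    inner_neg_left, real_inner_smul_left, inner_sub_right _ (z - x) (p - x),
    real_inner_self_eq_norm_sq] at h1
  have h6 : γ * ‖p - x‖ ^ 2 ≤ 1 * ‖p - x‖ ^ 2 := mul_le_mul_of_nonneg_right hγ1 (sq_nonneg _)
  linarith

end Prox

/-! ### Moreau envelopes -/

section Moreau

variable {n : ℕ} {Ψ : EuclideanSpace ℝ (Fin n) → ℝ}

/-- The Moreau envelope `min_z Ψ z + ½ ‖z - x‖²`, written as the value at `prox Ψ x`. -/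
noncomputable def moreau (Ψ : EuclideanSpace ℝ (Fin n) → ℝ) (x : EuclideanSpace ℝ (Fin n)) : ℝ :=
  Ψ (prox Ψ x) + 1 / 2 * ‖prox Ψ x - x‖ ^ 2

lemma moreau_le_add (hΨ : ConvexOn ℝ Set.univ Ψ) (hb : BddBelow (Set.range Ψ))
    (x z : EuclideanSpace ℝ (Fin n)) : moreau Ψ x ≤ Ψ z + 1 / 2 * ‖z - x‖ ^ 2 :=
  isProx_prox hΨ hb x z

lemma moreau_le (hΨ : ConvexOn ℝ Set.univ Ψ) (hb : BddBelow (Set.range Ψ))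
    (x : EuclideanSpace ℝ (Fin n)) : moreau Ψ x ≤ Ψ x := by
  simpa using moreau_le_add hΨ hb x x

lemma apply_prox_le_moreau (x : EuclideanSpace ℝ (Fin n)) : Ψ (prox Ψ x) ≤ moreau Ψ x := by
  have := sq_nonneg ‖prox Ψ x - x‖
  unfold moreau
  linarith

lemma continuous_moreau (hΨ : ConvexOn ℝ Set.univ Ψ) (hb : BddBelow (Set.range Ψ)) :
    Continuous (moreau Ψ) := by
  have h1 := hΨ.locallyLipschitz.continuous
  have h2 := (lipschitzWith_prox hΨ hb).continuous
  unfold moreau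
  fun_prop

/-- The descent inequality at `x - G x`, where `h` is still nonnegative, bounds the gradient. -/
lemma IsSmoothConvex.norm_sq_le {h : EuclideanSpace ℝ (Fin n) → ℝ}
    {G : EuclideanSpace ℝ (Fin n) → EuclideanSpace ℝ (Fin n)} (hG : IsSmoothConvex h G)
    (h0 : ∀ x, 0 ≤ h x) (x : EuclideanSpace ℝ (Fin n)) : ‖G x‖ ^ 2 ≤ 2 * h x := by
  have h1 := hG.apply_le x (x - G x)
  have h2 := h0 (x - G x)
  rw [sub_sub_cancel_left, norm_neg, inner_neg_right, real_inner_self_eq_norm_sq] at h1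
  linarith

/-- The nonnegative smooth part of the objective grows no faster than the envelope. -/
lemma IsSmoothConvex.le_moreau {φ h : EuclideanSpace ℝ (Fin n) → ℝ}
    {G : EuclideanSpace ℝ (Fin n) → EuclideanSpace ℝ (Fin n)} (hG : IsSmoothConvex h G)
    (h0 : ∀ x, 0 ≤ h x) {c : ℝ} (hc : ∀ x, c ≤ φ x) (x : EuclideanSpace ℝ (Fin n)) :
    h x ≤ 2 * (moreau (fun z => φ z + h z) x - c) := by
  set p := prox (fun z => φ z + h z) x with hp
  have h1 := hG.apply_le p x
  have h2 := hG.norm_sq_le h0 p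
  have h3 := hc p
  have h4 := sq_nonneg ‖G p - (x - p)‖
  rw [norm_sub_sq_real] at h4
  rw [norm_sub_rev x p] at h1 h4
  simp only [moreau, ← hp]
  linarith

end Moreau

/-! ### Square-integrable random vectors -/

section Square

variable {n : ℕ} {Ω : Type*} {mΩ : MeasurableSpace Ω} {μ : Measure Ω}

lemma _root_.LipschitzWith.memLp_comp [IsFiniteMeasure μ]
    {f : EuclideanSpace ℝ (Fin n) → EuclideanSpace ℝ (Fin n)} {K : NNReal}
    (hf : LipschitzWith K f) {u : Ω → EuclideanSpace ℝ (Fin n)} (hu : MemLp u 2 μ) :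
    MemLp (fun ω => f (u ω)) 2 μ := by
  have h1 : LipschitzWith K fun z => f z - f 0 :=
    LipschitzWith.of_dist_le_mul fun a b => by
      rw [dist_sub_right]; exact hf.dist_le_mul a b
  have h2 := h1.comp_memLp (by simp) hu
  refine (h2.add (memLp_const (f 0))).ae_eq (Eventually.of_forall fun ω => ?_)
  simp

lemma integrable_norm_sq {u : Ω → EuclideanSpace ℝ (Fin n)} (hu : MemLp u 2 μ) :
    Integrable (fun ω => ‖u ω‖ ^ 2) μ :=
  hu.integrable_norm_pow two_ne_zero

lemma integrable_norm_sub_sq {u v : Ω → EuclideanSpace ℝ (Fin n)} (hu : MemLp u 2 μ)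
    (hv : MemLp v 2 μ) : Integrable (fun ω => ‖u ω - v ω‖ ^ 2) μ :=
  integrable_norm_sq (hu.sub hv)

lemma integrable_inner {u v : Ω → EuclideanSpace ℝ (Fin n)} (hu : MemLp u 2 μ)
    (hv : MemLp v 2 μ) : Integrable (fun ω => ⟪u ω, v ω⟫) μ := by
  refine ((integrable_norm_sq hu).add (integrable_norm_sq hv)).mono'
    (hu.aestronglyMeasurable.inner hv.aestronglyMeasurable) (Eventually.of_forall fun ω => ?_)
  have h1 := norm_inner_le_norm (𝕜 := ℝ) (u ω) (v ω)
  have h2 := two_mul_le_add_sq ‖u ω‖ ‖v ω‖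
  have h3 := mul_nonneg (norm_nonneg (u ω)) (norm_nonneg (v ω))
  simp only [Pi.add_apply]
  linarith

/-- The error of a conditionally unbiased estimate is orthogonal to what is known. -/
lemma integral_inner_sub_eq_zero [IsProbabilityMeasure μ] {m : MeasurableSpace Ω} (hm : m ≤ mΩ)
    {g d z : Ω → EuclideanSpace ℝ (Fin n)} (hg : MemLp g 2 μ) (hd : MemLp d 2 μ)
    (hz : MemLp z 2 μ) (hzm : StronglyMeasurable[m] z) (hgd : μ[g | m] =ᵐ[μ] d) :
    ∫ ω, ⟪g ω - d ω, z ω⟫ ∂μ = 0 := by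
  have h1 := condExp_bilin_of_stronglyMeasurable_right (innerSL ℝ) hzm (μ := μ)
    (integrable_inner hg hz) (hg.integrable (by norm_num))
  have h2 : ∫ ω, ⟪g ω, z ω⟫ ∂μ = ∫ ω, ⟪d ω, z ω⟫ ∂μ := by
    rw [← integral_condExp hm]
    refine integral_congr_ae ?_
    filter_upwards [h1, hgd] with ω h3 h4
    refine h3.trans ?_
    rw [h4]
    rfl
  simp only [inner_sub_left]
  rw [integral_sub (integrable_inner hg hz) (integrable_inner hd hz), h2, sub_self]

/-- Jensen's inequality for the square, from the expansion of `(‖u‖ - E ‖u‖)² ≥ 0`. -/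
lemma sq_integral_norm_le [IsProbabilityMeasure μ] {u : Ω → EuclideanSpace ℝ (Fin n)}
    (hu : MemLp u 2 μ) : (∫ ω, ‖u ω‖ ∂μ) ^ 2 ≤ ∫ ω, ‖u ω‖ ^ 2 ∂μ := by
  set c := ∫ ω, ‖u ω‖ ∂μ with hc
  have h1 : ∫ ω, (2 * c * ‖u ω‖ - c ^ 2) ∂μ ≤ ∫ ω, ‖u ω‖ ^ 2 ∂μ := by
    refine integral_mono (((hu.integrable (by norm_num)).norm.const_mul _).sub
      (integrable_const _)) (integrable_norm_sq hu) fun ω => ?_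
    have := sq_nonneg (‖u ω‖ - c)
    simp only
    linarith
  rw [integral_sub ((hu.integrable (by norm_num)).norm.const_mul _) (integrable_const _),
    integral_const_mul, ← hc] at h1
  simp at h1
  linarith

end Square

/-! ### One step of the iteration in expectation -/

section Step

variable {n : ℕ} {Ω : Type*} {mΩ : MeasurableSpace Ω} {μ : Measure Ω} [IsProbabilityMeasure μ]
  {φ h : EuclideanSpace ℝ (Fin n) → ℝ} {G : EuclideanSpace ℝ (Fin n) → EuclideanSpace ℝ (Fin n)}

lemma integrable_of_le {Ψ : EuclideanSpace ℝ (Fin n) → ℝ} (hΨ : Continuous Ψ)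
    (hb : BddBelow (Set.range Ψ)) {u : Ω → EuclideanSpace ℝ (Fin n)}
    (hu : AEStronglyMeasurable u μ) {b : Ω → ℝ} (hbi : Integrable b μ)
    (hle : ∀ ω, Ψ (u ω) ≤ b ω) : Integrable (fun ω => Ψ (u ω)) μ := by
  obtain ⟨c, hc⟩ := hb
  exact integrable_of_le_of_le (hΨ.comp_aestronglyMeasurable hu)
    (Eventually.of_forall fun ω => hc ⟨u ω, rfl⟩) (Eventually.of_forall hle)
    (integrable_const c) hbi

lemma integrable_moreau {Ψ : EuclideanSpace ℝ (Fin n) → ℝ} (hΨ : ConvexOn ℝ Set.univ Ψ)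
    (hb : BddBelow (Set.range Ψ)) {u : Ω → EuclideanSpace ℝ (Fin n)} (hu : MemLp u 2 μ) :
    Integrable (fun ω => moreau Ψ (u ω)) μ := by
  refine integrable_of_le (continuous_moreau hΨ hb) ?_ hu.aestronglyMeasurable
    ((integrable_const (Ψ 0)).add ((integrable_norm_sq hu).const_mul (1 / 2))) fun ω => ?_
  · obtain ⟨c, hc⟩ := hb
    exact ⟨c, by rintro _ ⟨x, rfl⟩; exact (hc ⟨_, rfl⟩).trans (apply_prox_le_moreau x)⟩
  · simpa using moreau_le_add hΨ hb (u ω) 0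

lemma integrable_apply_prox {Ψ : EuclideanSpace ℝ (Fin n) → ℝ} (hΨ : ConvexOn ℝ Set.univ Ψ)
    (hb : BddBelow (Set.range Ψ)) {u : Ω → EuclideanSpace ℝ (Fin n)} (hu : MemLp u 2 μ) :
    Integrable (fun ω => Ψ (prox Ψ (u ω))) μ :=
  integrable_of_le hΨ.locallyLipschitz.continuous hb
    ((lipschitzWith_prox hΨ hb).memLp_comp hu).aestronglyMeasurable
    (integrable_moreau hΨ hb hu) fun ω => apply_prox_le_moreau (u ω)

lemma bddBelow_const_mul (hb : BddBelow (Set.range φ)) {γ : ℝ} (hγ : 0 < γ) :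
    BddBelow (Set.range fun z => γ * φ z) := by
  obtain ⟨c, hc⟩ := hb
  exact ⟨γ * c, by rintro _ ⟨x, rfl⟩; exact mul_le_mul_of_nonneg_left (hc ⟨x, rfl⟩) hγ.le⟩

lemma bddBelow_add (hb : BddBelow (Set.range φ)) (h0 : ∀ x, 0 ≤ h x) :
    BddBelow (Set.range fun z => φ z + h z) := by
  obtain ⟨c, hc⟩ := hb
  exact ⟨c, by rintro _ ⟨x, rfl⟩; exact le_add_of_le_of_nonneg (hc ⟨x, rfl⟩) (h0 x)⟩

/-- The expected form of `IsProx.norm_sub_sq_le`. The comparison point `z` may be random, as long as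
it is known before the step, for then the term linear in the error vanishes. -/
lemma integral_norm_sub_sq_le {m : MeasurableSpace Ω} (hm : m ≤ mΩ)
    (hφ : ConvexOn ℝ Set.univ φ) (hb : BddBelow (Set.range φ)) (hG : IsSmoothConvex h G)
    (h0 : ∀ x, 0 ≤ h x) {γ : ℝ} (hγ : 0 < γ) (hγ1 : γ ≤ 1)
    {x g p : Ω → EuclideanSpace ℝ (Fin n)} (hx : MemLp x 2 μ) (hxm : StronglyMeasurable[m] x)
    (hg : MemLp g 2 μ) (hgG : μ[g | m] =ᵐ[μ] fun ω => G (x ω))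
    (hp : ∀ ω, p ω = prox (fun z => γ * φ z) (x ω - γ • g ω)) :
    Integrable (fun ω => φ (p ω) + h (p ω)) μ ∧
    ∀ z : Ω → EuclideanSpace ℝ (Fin n), MemLp z 2 μ → StronglyMeasurable[m] z →
      Integrable (fun ω => φ (z ω) + h (z ω)) μ →
      ∫ ω, ‖p ω - z ω‖ ^ 2 ∂μ ≤ ∫ ω, ‖x ω - z ω‖ ^ 2 ∂μ
        - 2 * γ * (∫ ω, (φ (p ω) + h (p ω)) ∂μ - ∫ ω, (φ (z ω) + h (z ω)) ∂μ)
        + 2 * γ ^ 2 * ∫ ω, ‖g ω - G (x ω)‖ ^ 2 ∂μ := by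
  have hγφ : ConvexOn ℝ Set.univ fun z => γ * φ z := hφ.smul hγ.le
  have hγb := bddBelow_const_mul hb hγ
  have hlip := lipschitzWith_prox hγφ hγb
  have hp2 : MemLp p 2 μ := by
    rw [funext hp]
    exact hlip.memLp_comp (hx.sub (hg.const_smul γ))
  have hGx : MemLp (fun ω => G (x ω)) 2 μ := hG.lipschitzWith.memLp_comp hx
  have he : MemLp (fun ω => g ω - G (x ω)) 2 μ := hg.sub hGx
  -- the exact step
  set y : Ω → EuclideanSpace ℝ (Fin n) :=
    fun ω => prox (fun z => γ * φ z) (x ω - γ • G (x ω)) with hy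
  have hy2 : MemLp y 2 μ := hlip.memLp_comp (hx.sub (hGx.const_smul γ))
  have hym : StronglyMeasurable[m] y :=
    hlip.continuous.comp_stronglyMeasurable
      (hxm.sub ((hG.lipschitzWith.continuous.comp_stronglyMeasurable hxm).const_smul γ))
  have key : ∀ ω z, 2 * γ * (φ (p ω) + h (p ω)) + ‖p ω - z‖ ^ 2 ≤
      ‖x ω - z‖ ^ 2 + 2 * γ * (φ z + h z) + 2 * γ ^ 2 * ‖g ω - G (x ω)‖ ^ 2
        - 2 * γ * ⟪g ω - G (x ω), y ω - z⟫ := by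
    intro ω z
    have h1 := isProx_prox hγφ hγb (x ω - γ • g ω)
    rw [← hp] at h1
    have := h1.norm_sub_sq_le hφ hG hγ hγ1 (isProx_prox hγφ hγb (x ω - γ • G (x ω))) z
    linarith
  have hrhs : ∀ z : Ω → EuclideanSpace ℝ (Fin n), MemLp z 2 μ →
      Integrable (fun ω => φ (z ω) + h (z ω)) μ →
      Integrable (fun ω => ‖x ω - z ω‖ ^ 2 + 2 * γ * (φ (z ω) + h (z ω))
        + 2 * γ ^ 2 * ‖g ω - G (x ω)‖ ^ 2 - 2 * γ * ⟪g ω - G (x ω), y ω - z ω⟫) μ :=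
    fun z hz hzi => ((((integrable_norm_sub_sq hx hz).add (hzi.const_mul _)).add
      ((integrable_norm_sq he).const_mul _))).sub
        ((integrable_inner he (hy2.sub hz)).const_mul _)
  have hΨ : ConvexOn ℝ Set.univ fun z => φ z + h z := hφ.add hG.convexOn
  have hpi : Integrable (fun ω => φ (p ω) + h (p ω)) μ := by
    refine integrable_of_le hΨ.locallyLipschitz.continuous (bddBelow_add hb h0)
      hp2.aestronglyMeasurable
      ((hrhs (fun _ => 0) (memLp_const 0) (integrable_const _)).const_mul (1 / (2 * γ)))
      fun ω => ?_
    rw [one_div, ← div_eq_inv_mul, le_div_iff₀ (by positivity)]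
    have := key ω 0
    have := sq_nonneg ‖p ω - 0‖
    linarith
  refine ⟨hpi, fun z hz hzm hzi => ?_⟩
  have hyz : MemLp (fun ω => y ω - z ω) 2 μ := hy2.sub hz
  have hint := integral_mono ((hpi.const_mul (2 * γ)).add (integrable_norm_sub_sq hp2 hz))
    (hrhs z hz hzi) fun ω => key ω (z ω)
  have horth := integral_inner_sub_eq_zero hm hg hGx hyz (hym.sub hzm) hgG
  simp only [Pi.add_apply] at hint horth
  have i1 : Integrable (fun ω => ‖x ω - z ω‖ ^ 2 + 2 * γ * (φ (z ω) + h (z ω))) μ :=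
    (integrable_norm_sub_sq hx hz).add (hzi.const_mul _)
  have i2 : Integrable (fun ω => ‖x ω - z ω‖ ^ 2 + 2 * γ * (φ (z ω) + h (z ω))
      + 2 * γ ^ 2 * ‖g ω - G (x ω)‖ ^ 2) μ := i1.add ((integrable_norm_sq he).const_mul _)
  rw [integral_add (hpi.const_mul _) (integrable_norm_sub_sq hp2 hz),
    integral_sub i2 ((integrable_inner he hyz).const_mul _),
    integral_add i1 ((integrable_norm_sq he).const_mul _),
    integral_add (integrable_norm_sub_sq hx hz) (hzi.const_mul _)] at hint
  simp only [integral_const_mul, horth] at hint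
  linarith

/-- The expected envelope grows by at most a term of second order in the step size. The comparison
point is the proximal point of the current iterate. -/
lemma integral_moreau_le {m : MeasurableSpace Ω} (hm : m ≤ mΩ)
    (hφ : ConvexOn ℝ Set.univ φ) (hb : BddBelow (Set.range φ)) (hG : IsSmoothConvex h G)
    (h0 : ∀ x, 0 ≤ h x) {γ : ℝ} (hγ : 0 < γ) (hγ1 : γ ≤ 1)
    {x g p : Ω → EuclideanSpace ℝ (Fin n)} (hx : MemLp x 2 μ) (hxm : StronglyMeasurable[m] x)
    (hp2 : MemLp p 2 μ) (hg : MemLp g 2 μ) (hgG : μ[g | m] =ᵐ[μ] fun ω => G (x ω))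
    (hp : ∀ ω, p ω = prox (fun z => γ * φ z) (x ω - γ • g ω)) :
    ∫ ω, moreau (fun z => φ z + h z) (p ω) ∂μ ≤ ∫ ω, moreau (fun z => φ z + h z) (x ω) ∂μ
      + γ ^ 2 * ∫ ω, ‖g ω - G (x ω)‖ ^ 2 ∂μ := by
  set Ψ : EuclideanSpace ℝ (Fin n) → ℝ := fun z => φ z + h z with hΨdef
  have hΨ : ConvexOn ℝ Set.univ Ψ := hφ.add hG.convexOn
  have hΨb : BddBelow (Set.range Ψ) := bddBelow_add hb h0
  have hS : 0 ≤ γ ^ 2 * ∫ ω, ‖g ω - G (x ω)‖ ^ 2 ∂μ :=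
    mul_nonneg (sq_nonneg _) (integral_nonneg fun _ => sq_nonneg _)
  set z : Ω → EuclideanSpace ℝ (Fin n) := fun ω => prox Ψ (x ω) with hz
  have hlip := lipschitzWith_prox hΨ hΨb
  have hz2 : MemLp z 2 μ := hlip.memLp_comp hx
  have hzm : StronglyMeasurable[m] z := hlip.continuous.comp_stronglyMeasurable hxm
  have hzi : Integrable (fun ω => Ψ (z ω)) μ := integrable_apply_prox hΨ hΨb hx
  obtain ⟨hpi, hstep⟩ := integral_norm_sub_sq_le hm hφ hb hG h0 hγ hγ1 hx hxm hg hgG hp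
  have hstep := hstep z hz2 hzm hzi
  have h1 : ∫ ω, moreau Ψ (p ω) ∂μ ≤ ∫ ω, Ψ (z ω) ∂μ + 1 / 2 * ∫ ω, ‖p ω - z ω‖ ^ 2 ∂μ := by
    rw [← integral_const_mul,
      ← integral_add hzi ((integrable_norm_sub_sq hp2 hz2).const_mul _)]
    refine integral_mono (integrable_moreau hΨ hΨb hp2)
      (hzi.add ((integrable_norm_sub_sq hp2 hz2).const_mul _)) fun ω => ?_
    rw [norm_sub_rev]
    exact moreau_le_add hΨ hΨb _ _
  have h2 : ∫ ω, moreau Ψ (x ω) ∂μ = ∫ ω, Ψ (z ω) ∂μ + 1 / 2 * ∫ ω, ‖x ω - z ω‖ ^ 2 ∂μ := by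
    rw [← integral_const_mul,
      ← integral_add hzi ((integrable_norm_sub_sq hx hz2).const_mul _)]
    refine integral_congr_ae (Eventually.of_forall fun ω => ?_)
    simp only [moreau]
    rw [norm_sub_rev]
  have h3 : ∫ ω, moreau Ψ (p ω) ∂μ ≤ ∫ ω, Ψ (p ω) ∂μ :=
    integral_mono (integrable_moreau hΨ hΨb hp2) hpi fun ω => moreau_le hΨ hΨb _
  -- If the envelope did grow, then so did the objective beyond its value at the comparison point,
  -- and the corresponding term of the one-step inequality has a favourable sign.
  by_contra! hcon
  have h4 : ∫ ω, Ψ (z ω) ∂μ ≤ ∫ ω, moreau Ψ (x ω) ∂μ :=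
    integral_mono hzi (integrable_moreau hΨ hΨb hx) fun ω => apply_prox_le_moreau _
  have h5 : 0 ≤ γ * (∫ ω, Ψ (p ω) ∂μ - ∫ ω, Ψ (z ω) ∂μ) := mul_nonneg hγ.le (by linarith)
  simp only [hΨdef] at *
  linarith

end Step

/-! ### Real sequences with summable errors -/

section Sequences

/-- A nonnegative sequence that increases only by summable amounts converges. -/
lemma exists_tendsto_of_le_add {V β : ℕ → ℝ} (hV : ∀ k, 0 ≤ V k) (hβ0 : ∀ k, 0 ≤ β k)
    (hβ : Summable β) (h : ∀ k, V (k + 1) ≤ V k + β k) : ∃ L, Tendsto V atTop (𝓝 L) := by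
  have hanti : Antitone fun k => V k - ∑ i ∈ Finset.range k, β i := by
    refine antitone_nat_of_succ_le fun k => ?_
    rw [Finset.sum_range_succ]
    linarith [h k]
  have hbdd : BddBelow (Set.range fun k => V k - ∑ i ∈ Finset.range k, β i) := by
    refine ⟨-∑' i, β i, ?_⟩
    rintro _ ⟨k, rfl⟩
    have := hβ.sum_le_tsum (Finset.range k) fun i _ => hβ0 i
    have := hV k
    simp only
    linarith
  refine ⟨_, ((tendsto_atTop_ciInf hanti hbdd).add hβ.hasSum.tendsto_sum_nat).congr fun k => ?_⟩
  simp

/-- A discrete Grönwall inequality with summable coefficients. -/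
lemma exists_forall_le_of_le_add_mul {V α : ℕ → ℝ} {a b : ℝ} (ha : 0 ≤ a) (hb : 0 ≤ b)
    (hV : ∀ k, 0 ≤ V k) (hα0 : ∀ k, 0 ≤ α k) (hα : Summable α)
    (h : ∀ k, V (k + 1) ≤ V k + α k * (a * V k + b)) : ∃ M, ∀ k, V k ≤ M := by
  have key : ∀ k, V k + 1 ≤ (V 0 + 1) * Real.exp ((a + b) * ∑ i ∈ Finset.range k, α i) := by
    intro k
    induction k with
    | zero => simp
    | succ k ih =>
      rw [Finset.sum_range_succ, mul_add, Real.exp_add, ← mul_assoc]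
      have h1 : V (k + 1) + 1 ≤ (V k + 1) * ((a + b) * α k + 1) := by
        have := mul_nonneg (hα0 k) ha
        have := mul_nonneg (mul_nonneg (hα0 k) hb) (hV k)
        linarith [h k]
      refine h1.trans (mul_le_mul ih (Real.add_one_le_exp _) ?_ ?_)
      · have := mul_nonneg (add_nonneg ha hb) (hα0 k)
        linarith
      · have := hV 0
        positivity
  refine ⟨(V 0 + 1) * Real.exp ((a + b) * ∑' i, α i), fun k => ?_⟩
  have h1 := hα.sum_le_tsum (Finset.range k) fun i _ => hα0 i
  have h2 : (V 0 + 1) * Real.exp ((a + b) * ∑ i ∈ Finset.range k, α i) ≤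
      (V 0 + 1) * Real.exp ((a + b) * ∑' i, α i) := by
    have := hV 0
    gcongr
  linarith [key k]

/-- If the steps `γ` have a divergent sum, a sequence `D ≥ 0` cannot keep decreasing by `γ k * δ`
up to summable errors, so the limit of `V` is at most `c`. -/
lemma le_of_tendsto_of_le_sub_mul {V D β γ : ℕ → ℝ} {L c : ℝ} (hV : Tendsto V atTop (𝓝 L))
    (hD : ∀ k, 0 ≤ D k) (hβ0 : ∀ k, 0 ≤ β k) (hβ : Summable β) (hγ0 : ∀ k, 0 < γ k)
    (hγ : Tendsto (fun N => ∑ k ∈ Finset.range N, γ k) atTop atTop)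
    (h : ∀ k, D (k + 1) ≤ D k - γ k * (V (k + 1) - c) + β k) : L ≤ c := by
  by_contra! hLc
  set δ := (L - c) / 2 with hδ
  have hδ0 : 0 < δ := by linarith
  obtain ⟨N, hN⟩ := eventually_atTop.1 (hV.eventually (lt_mem_nhds (show c + δ < L by linarith)))
  have key : ∀ k, N ≤ k → D k + δ * ∑ i ∈ Finset.range k, γ i ≤
      D N + δ * ∑ i ∈ Finset.range N, γ i + ∑ i ∈ Finset.range k, β i := by
    intro k hk
    induction k, hk using Nat.le_induction with
    | base => linarith [Finset.sum_nonneg fun i (_ : i ∈ Finset.range N) => hβ0 i]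
    | succ k hk ih =>
      rw [Finset.sum_range_succ, Finset.sum_range_succ _ k, mul_add]
      have h1 := hN (k + 1) (by omega)
      have h2 : γ k * δ ≤ γ k * (V (k + 1) - c) :=
        mul_le_mul_of_nonneg_left (by linarith) (hγ0 k).le
      linarith [h k]
  obtain ⟨k, hk, hkN⟩ := ((hγ.eventually_gt_atTop ((D N + δ * ∑ i ∈ Finset.range N, γ i
    + ∑' i, β i) / δ)).and (eventually_ge_atTop N)).exists
  rw [div_lt_iff₀ hδ0] at hk
  have h1 := hβ.sum_le_tsum (Finset.range k) fun i _ => hβ0 i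
  have h2 := key k hkN
  have h3 := hD k
  linarith

end Sequences

/-! ### Convergence of the stochastic iteration -/

section Convergence

variable {n : ℕ} {Ω : Type*} {mΩ : MeasurableSpace Ω} {μ : Measure Ω} [IsProbabilityMeasure μ]
  {φ h : EuclideanSpace ℝ (Fin n) → ℝ} {G : EuclideanSpace ℝ (Fin n) → EuclideanSpace ℝ (Fin n)}

/-- The stochastic proximal gradient method for `φ + h`: the distance of the iterates from their
proximal points tends to zero in mean square. No minimizer of `φ + h` is needed. -/
theorem tendsto_integral_norm_sub_prox_sq {𝓖 : ℕ → MeasurableSpace Ω} (h𝓖 : ∀ k, 𝓖 k ≤ mΩ)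
    (hφ : ConvexOn ℝ Set.univ φ) (hb : BddBelow (Set.range φ)) (hG : IsSmoothConvex h G)
    (h0 : ∀ x, 0 ≤ h x) {γ : ℕ → ℝ} (hγ : ∀ k, 0 < γ k) (hγ1 : ∀ k, γ k ≤ 1)
    (hγ_sum : Tendsto (fun N => ∑ k ∈ Finset.range N, γ k) atTop atTop)
    (hγ_sq : Summable fun k => γ k ^ 2)
    {x g : ℕ → Ω → EuclideanSpace ℝ (Fin n)} (hx : ∀ k, MemLp (x k) 2 μ)
    (hxm : ∀ k, StronglyMeasurable[𝓖 k] (x k)) (hg : ∀ k, MemLp (g k) 2 μ)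
    (hgG : ∀ k, μ[g k | 𝓖 k] =ᵐ[μ] fun ω => G (x k ω))
    (hstep : ∀ k ω, x (k + 1) ω = prox (fun z => γ k * φ z) (x k ω - γ k • g k ω))
    {a b : ℝ} (ha : 0 ≤ a) (hb0 : 0 ≤ b)
    (hvar : ∀ k, ∫ ω, ‖g k ω - G (x k ω)‖ ^ 2 ∂μ ≤ a * ∫ ω, h (x k ω) ∂μ + b) :
    Tendsto (fun k => ∫ ω, ‖x k ω - prox (fun z => φ z + h z) (x k ω)‖ ^ 2 ∂μ) atTop (𝓝 0) := by
  set Ψ : EuclideanSpace ℝ (Fin n) → ℝ := fun z => φ z + h z with hΨdef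
  have hΨ : ConvexOn ℝ Set.univ Ψ := hφ.add hG.convexOn
  have hΨb : BddBelow (Set.range Ψ) := bddBelow_add hb h0
  obtain ⟨c, hc⟩ := id hb
  replace hc : ∀ z, c ≤ φ z := fun z => hc ⟨z, rfl⟩
  have hmi : ∀ k, Integrable (fun ω => moreau Ψ (x k ω)) μ :=
    fun k => integrable_moreau hΨ hΨb (hx k)
  have hcm : ∀ z, c ≤ moreau Ψ z := fun z =>
    ((hc _).trans (le_add_of_nonneg_right (h0 _))).trans (apply_prox_le_moreau (Ψ := Ψ) z)
  set V : ℕ → ℝ := fun k => ∫ ω, moreau Ψ (x k ω) ∂μ - c with hV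
  set S : ℕ → ℝ := fun k => ∫ ω, ‖g k ω - G (x k ω)‖ ^ 2 ∂μ with hS
  have hVint : ∀ k, V k = ∫ ω, (moreau Ψ (x k ω) - c) ∂μ := fun k => by
    rw [integral_sub (hmi k) (integrable_const c)]
    simp [hV]
  have hV0 : ∀ k, 0 ≤ V k := fun k => by
    rw [hVint]
    exact integral_nonneg fun ω => sub_nonneg.2 (hcm _)
  have hS0 : ∀ k, 0 ≤ S k := fun k => integral_nonneg fun _ => sq_nonneg _
  have hSV : ∀ k, S k ≤ 2 * a * V k + b := by
    intro k
    have h1 : ∫ ω, h (x k ω) ∂μ ≤ 2 * V k := by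
      rw [hVint, ← integral_const_mul]
      exact integral_mono_of_nonneg (Eventually.of_forall fun ω => h0 _)
        (((hmi k).sub (integrable_const c)).const_mul 2)
        (Eventually.of_forall fun ω => hG.le_moreau h0 hc _)
    have h2 := hvar k
    have h3 := mul_le_mul_of_nonneg_left h1 ha
    simp only [hS]
    linarith
  have hVS : ∀ k, V (k + 1) ≤ V k + γ k ^ 2 * S k := by
    intro k
    have := integral_moreau_le (h𝓖 k) hφ hb hG h0 (hγ k) (hγ1 k) (hx k) (hxm k) (hx (k + 1))
      (hg k) (hgG k) (hstep k)
    simp only [hV, hS, hΨdef]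
    linarith
  obtain ⟨M, hM⟩ := exists_forall_le_of_le_add_mul (mul_nonneg zero_le_two ha) hb0 hV0
    (fun k => sq_nonneg (γ k)) hγ_sq fun k => (hVS k).trans
      (add_le_add_right (mul_le_mul_of_nonneg_left (hSV k) (sq_nonneg _)) _)
  -- the boundedness of `V` makes the error terms summable
  set β : ℕ → ℝ := fun k => γ k ^ 2 * S k with hβ
  have hβ0 : ∀ k, 0 ≤ β k := fun k => mul_nonneg (sq_nonneg _) (hS0 k)
  have hβs : Summable β := by
    refine Summable.of_nonneg_of_le hβ0 (fun k => ?_) (hγ_sq.mul_right (2 * a * M + b))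
    refine mul_le_mul_of_nonneg_left ((hSV k).trans ?_) (sq_nonneg _)
    have := mul_le_mul_of_nonneg_left (hM k) (mul_nonneg zero_le_two ha)
    linarith
  obtain ⟨L, hL⟩ := exists_tendsto_of_le_add hV0 hβ0 hβs hVS
  -- the one-step inequality with a constant comparison point
  have hLz : ∀ z, L ≤ Ψ z - c := by
    intro z
    refine le_of_tendsto_of_le_sub_mul (γ := fun k => γ k) (β := fun k => β k)
      (D := fun k => 1 / 2 * ∫ ω, ‖x k ω - z‖ ^ 2 ∂μ) hL
      (fun k => mul_nonneg (by norm_num) (integral_nonneg fun _ => sq_nonneg _))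
      hβ0 hβs hγ hγ_sum fun k => ?_
    obtain ⟨hpi, h1⟩ := integral_norm_sub_sq_le (h𝓖 k) hφ hb hG h0 (hγ k) (hγ1 k) (hx k) (hxm k)
      (hg k) (hgG k) (hstep k)
    have h2 := h1 (fun _ => z) (memLp_const z) stronglyMeasurable_const (integrable_const _)
    have h3 : ∫ ω, moreau Ψ (x (k + 1) ω) ∂μ ≤ ∫ ω, (φ (x (k + 1) ω) + h (x (k + 1) ω)) ∂μ :=
      integral_mono (hmi (k + 1)) hpi fun ω => moreau_le hΨ hΨb _
    have h4 := mul_le_mul_of_nonneg_left h3 (hγ k).le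
    simp only [integral_const, probReal_univ, one_smul] at h2
    simp only [hV, hβ, hS, hΨdef] at *
    linarith
  have hLinf : L ≤ sInf (Set.range Ψ) - c := by
    have : L + c ≤ sInf (Set.range Ψ) := by
      refine le_csInf (Set.range_nonempty Ψ) ?_
      rintro _ ⟨z, rfl⟩
      linarith [hLz z]
    linarith
  have hle : ∀ k, ∫ ω, ‖x k ω - prox Ψ (x k ω)‖ ^ 2 ∂μ ≤
      2 * (V k - (sInf (Set.range Ψ) - c)) := by
    intro k
    have h1 : ∫ ω, ‖x k ω - prox Ψ (x k ω)‖ ^ 2 ∂μ ≤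
        ∫ ω, 2 * (moreau Ψ (x k ω) - sInf (Set.range Ψ)) ∂μ := by
      refine integral_mono_of_nonneg (Eventually.of_forall fun _ => sq_nonneg _)
        (((hmi k).sub (integrable_const _)).const_mul 2) (Eventually.of_forall fun ω => ?_)
      have := csInf_le hΨb ⟨prox Ψ (x k ω), rfl⟩
      simp only [moreau]
      rw [norm_sub_rev]
      linarith
    rw [integral_const_mul, integral_sub (hmi k) (integrable_const _)] at h1
    simp only [integral_const, probReal_univ, one_smul] at h1
    simp only [hV]
    linarith
  have hlim : Tendsto (fun k => 2 * (V k - (sInf (Set.range Ψ) - c))) atTop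
      (𝓝 (2 * (L - (sInf (Set.range Ψ) - c)))) := (hL.sub_const _).const_mul 2
  have hnn := fun k => integral_nonneg (μ := μ)
    (f := fun ω => ‖x k ω - prox Ψ (x k ω)‖ ^ 2) fun _ => sq_nonneg _
  have hlim0 : 2 * (L - (sInf (Set.range Ψ) - c)) = 0 :=
    le_antisymm (by linarith) (ge_of_tendsto' hlim fun k => (hnn k).trans (hle k))
  rw [hlim0] at hlim
  exact squeeze_zero hnn hle hlim

end Convergence

end FiRe

theorem mainTheorem2 {n m : ℕ} {Ω : Type*} {mΩ : MeasurableSpace Ω}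
    (μ : Measure Ω) [IsProbabilityMeasure μ] (ℱ : Filtration ℕ mΩ)
    -- the data-fidelity term and its weight
    (f : EuclideanSpace ℝ (Fin n) → ℝ) (hf : ConvexOn ℝ Set.univ f)
    (hf_bdd : BddBelow (Set.range f)) (lam : ℝ) (hlam : 0 < lam)
    -- the set attached to the restoration model
    (C : Set (EuclideanSpace ℝ (Fin n))) (hC_closed : IsClosed C) (hC_nonempty : C.Nonempty)
    (hC_diff : Differentiable ℝ (FiRe.sqDist C))
    -- the restoration model, the random degradations, the noise and the iterates
    (R : EuclideanSpace ℝ (Fin m) → EuclideanSpace ℝ (Fin n))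
    (H : ℕ → Ω → EuclideanSpace ℝ (Fin n) → EuclideanSpace ℝ (Fin m))
    (w : ℕ → Ω → EuclideanSpace ℝ (Fin m))
    (x g : ℕ → Ω → EuclideanSpace ℝ (Fin n)) (γ : ℕ → ℝ)
    (hx_adapted : StronglyAdapted ℱ x) (hx_zero : MemLp (x 0) 2 μ)
    (hg : ∀ k ω, g k ω = FiRe.estimate R (H k ω) (w k ω) (x k ω))
    (hx_step : ∀ k ω, x (k + 1) ω =
      FiRe.prox (fun z => γ k * (lam * f z)) (x k ω - γ k • g k ω))
    -- unbiasedness and conditional variance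
    (hg_memLp : ∀ k, MemLp (g k) 2 μ)
    (hg_unbiased : ∀ k, μ[g k | ℱ k] =ᵐ[μ] fun ω => FiRe.halfGradSqDist C (x k ω))
    (A B : ℝ) (hA : 0 ≤ A) (hB : 0 ≤ B)
    (hg_var : ∀ k, μ[fun ω => ‖g k ω - FiRe.halfGradSqDist C (x k ω)‖ ^ 2 | ℱ k] ≤ᵐ[μ]
      fun ω => A * FiRe.sqDist C (x k ω) + B)
    -- step sizes
    (hγ_pos : ∀ k, 0 < γ k)
    (hγ_sum : Tendsto (fun N => ∑ k ∈ Finset.range N, γ k) atTop atTop)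
    (hγ_sq : Summable fun k => γ k ^ 2) :
    (∀ k, Integrable (fun ω => FiRe.residual lam f C (x k ω)) μ) ∧
    Tendsto (fun k => ∫ ω, FiRe.residual lam f C (x k ω) ∂μ) atTop (𝓝 0) ∧
    Tendsto (fun k => ∫ ω, ‖FiRe.residual lam f C (x k ω)‖ ∂μ) atTop (𝓝 0) := by
  have hφ : ConvexOn ℝ Set.univ fun z => lam * f z := hf.smul hlam.le
  have hb : BddBelow (Set.range fun z => lam * f z) := FiRe.bddBelow_const_mul hf_bdd hlam
  have hG := FiRe.isSmoothConvex_sqDist hC_closed hC_nonempty hC_diff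
  have h0 : ∀ z, 0 ≤ 1 / 2 * FiRe.sqDist C z := fun z =>
    mul_nonneg (by norm_num) (FiRe.sqDist_nonneg z)
  have hprox := FiRe.lipschitzWith_prox hφ hb
  have hx : ∀ k, MemLp (x k) 2 μ := by
    intro k
    induction k with
    | zero => exact hx_zero
    | succ k ih =>
      rw [funext (hx_step k)]
      exact (FiRe.lipschitzWith_prox (hφ.smul (hγ_pos k).le)
        (FiRe.bddBelow_const_mul hb (hγ_pos k))).memLp_comp (ih.sub ((hg_memLp k).const_smul (γ k)))
  have hF : ∀ k, MemLp (fun ω => FiRe.residual lam f C (x k ω)) 2 μ := fun k =>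
    (hx k).sub (hprox.memLp_comp ((hx k).sub (hG.lipschitzWith.memLp_comp (hx k))))
  have hvar : ∀ k, ∫ ω, ‖g k ω - FiRe.halfGradSqDist C (x k ω)‖ ^ 2 ∂μ ≤
      2 * A * ∫ ω, 1 / 2 * FiRe.sqDist C (x k ω) ∂μ + B := by
    intro k
    obtain ⟨c, hc⟩ := hC_nonempty
    have hi : Integrable (fun ω => FiRe.sqDist C (x k ω)) μ :=
      FiRe.integrable_of_le hC_diff.continuous
        ⟨0, by rintro _ ⟨z, rfl⟩; exact FiRe.sqDist_nonneg z⟩ (hx k).aestronglyMeasurable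
        (FiRe.integrable_norm_sub_sq (hx k) (memLp_const c)) fun ω => FiRe.sqDist_le hc (x k ω)
    have h1 := integral_mono_ae integrable_condExp
      ((hi.const_mul A).add (integrable_const B)) (hg_var k)
    rw [integral_condExp (ℱ.le k)] at h1
    rw [integral_add' (hi.const_mul A) (integrable_const B),
      integral_const_mul] at h1
    simp only [integral_const, probReal_univ, one_smul] at h1
    rw [integral_const_mul]
    linarith
  -- the step sizes are at most one from some index `K` on
  obtain ⟨K, hK⟩ : ∃ K, ∀ k, γ (k + K) ≤ 1 := by
    obtain ⟨K, hK⟩ := eventually_atTop.1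
      (hγ_sq.tendsto_atTop_zero.eventually (gt_mem_nhds zero_lt_one))
    refine ⟨K, fun k => ?_⟩
    have := hK (k + K) (by omega)
    exact ((sq_lt_one_iff₀ (hγ_pos _).le).1 this).le
  have hshift : Tendsto (fun N => ∑ k ∈ Finset.range N, γ (k + K)) atTop atTop := by
    have h1 := (tendsto_add_atTop_iff_nat K).2 hγ_sum
    refine (tendsto_atTop_add_const_right _ (-∑ k ∈ Finset.range K, γ k) h1).congr fun N => ?_
    rw [add_comm N K, Finset.sum_range_add]
    simp [add_comm K]
  have hmain := FiRe.tendsto_integral_norm_sub_prox_sq (μ := μ) (𝓖 := fun k => ℱ (k + K))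
    (fun k => ℱ.le _) hφ hb hG h0 (fun k => hγ_pos (k + K)) hK hshift
    ((summable_nat_add_iff K).2 hγ_sq) (fun k => hx (k + K)) (fun k => hx_adapted (k + K))
    (fun k => hg_memLp (k + K)) (fun k => hg_unbiased (k + K))
    (fun k ω => by rw [← hx_step, Nat.add_right_comm])
    (mul_nonneg zero_le_two hA) hB (fun k => hvar (k + K))
  have hmain := (tendsto_add_atTop_iff_nat (f := fun k => ∫ ω, ‖x k ω -
    FiRe.prox (fun z => lam * f z + 1 / 2 * FiRe.sqDist C z) (x k ω)‖ ^ 2 ∂μ) K).1 hmain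
  have hsq : ∀ k, (∫ ω, ‖FiRe.residual lam f C (x k ω)‖ ∂μ) ^ 2 ≤ 4 * ∫ ω, ‖x k ω -
      FiRe.prox (fun z => lam * f z + 1 / 2 * FiRe.sqDist C z) (x k ω)‖ ^ 2 ∂μ := by
    intro k
    refine (FiRe.sq_integral_norm_le (hF k)).trans ?_
    have hΨ : ConvexOn ℝ Set.univ fun z => lam * f z + 1 / 2 * FiRe.sqDist C z :=
      hφ.add hG.convexOn
    have hΨb := FiRe.bddBelow_add hb h0
    rw [← integral_const_mul]
    refine integral_mono (FiRe.integrable_norm_sq (hF k)) ((FiRe.integrable_norm_sub_sq (hx k)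
      ((FiRe.lipschitzWith_prox hΨ hΨb).memLp_comp (hx k))).const_mul 4) fun ω => ?_
    have h1 := (FiRe.isProx_prox hΨ hΨb (x k ω)).norm_sub_prox_le hφ hb hG
    have h2 := pow_le_pow_left₀ (norm_nonneg _) h1 2
    rw [mul_pow] at h2
    norm_num at h2
    simpa [FiRe.residual] using h2
  have hnorm : Tendsto (fun k => ∫ ω, ‖FiRe.residual lam f C (x k ω)‖ ∂μ) atTop (𝓝 0) := by
    have h1 : Tendsto (fun k => (∫ ω, ‖FiRe.residual lam f C (x k ω)‖ ∂μ) ^ 2) atTop (𝓝 0) :=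
      squeeze_zero (fun k => sq_nonneg _) hsq (by simpa using hmain.const_mul 4)
    have h2 := h1.sqrt
    rw [Real.sqrt_zero] at h2
    exact h2.congr fun k => Real.sqrt_sq (integral_nonneg fun _ => norm_nonneg _)
  exact ⟨fun k => (hF k).integrable (by norm_num),
    squeeze_zero_norm (fun k => norm_integral_le_integral_norm _) hnorm, hnorm⟩
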